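/- Let $\mathbb{S}^n$ be the space of real symmetric $n\times n$ matrices with the Frobenius norm. A twice-differentiable function $\phi:\mathbb{S}^n\to\mathbb{R}$ is called $L$-smooth and $\mu$-strongly convex ($\mu>0$) if $$\mu\|E\|_F^2\le\langle\nabla^2\phi(M)[E],E\rangle\le L\|E\|_F^2\qquad\text{for all }M,E\in\mathbb{S}^n .$$ For $r\ge 0$ let $f_\phi:\mathbb{R}^{n\times r}\to\mathbb{R}$, $f_\phi(U)=\phi(UU^T)$. We say that $f=f_\phi$ has no spurious local minima if $\min_U f(U)$ is attained and, for every $X\in\mathbb{R}^{n\times r}$, $$\nabla f(X)=0,\ \ \nabla^2 f(X)\succeq 0\quad\Longleftrightarrow\quad f(X)=\min_U f(U).$$ **Corollary (Exact parameterization).** Let $n,r\ge 0$ be integers and let $L,\mu$ be real numbers with $\mu>0$. * If $L/\mu<3$, then for every twice-differentiable, $L$-smooth and $\mu$-strongly convex $\phi:\mathbb{S}^n\to\mathbb{R}$ whose minimizer $M^\star=\arg\min_{M\succeq0}\phi(M)$ satisfies $\mathrm{rank}(M^\star)\le r$, the function $f_\phi$ on $\mathbb{R}^{n\times r}$ has no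 spurious local minima. * If $L/\mu\ge3$ and $1\le r<n$, then there is a counterexample: a twice-differentiable, $L$-smooth and $\mu$-strongly convex $\phi_0:\mathbb{S}^n\to\mathbb{R}$ with minimizer $M_0^\star=\arg\min_{M\succeq0}\phi_0(M)$ of rank exactly $r$, such that $f_0=f_{\phi_0}$ attains its minimum over $\mathbb{R}^{n\times r}$ and there is a point $X\in\mathbb{R}^{n\times r}$ with $$\nabla f_0(X)=0,\qquad \nabla^2 f_0(X)\succeq0,\qquad f_0(X)-\min_U f_0(U)>\mu .$$ -/

import Mathlib

/-! Matrices carry the Frobenius norm throughout. -/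

attribute [local instance] Matrix.frobeniusNormedAddCommGroup Matrix.frobeniusNormedSpace

/-- The real symmetric `n × n` matrices, as a linear subspace of all `n × n` matrices. -/
def symSubmodule (n : ℕ) : Submodule ℝ (Matrix (Fin n) (Fin n) ℝ) where
  carrier := {M | M.IsSymm}
  add_mem' := fun hA hB => Matrix.IsSymm.add hA hB
  zero_mem' := Matrix.isSymm_zero
  smul_mem' := fun c _ hA => Matrix.IsSymm.smul hA c

/-- The space `𝕊ⁿ` of real symmetric `n × n` matrices, with the Frobenius norm
inherited from the space of all matrices. -/
def SymMat (n : ℕ) : Type := symSubmodule n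

noncomputable instance (n : ℕ) : NormedAddCommGroup (SymMat n) :=
  inferInstanceAs (NormedAddCommGroup (symSubmodule n))

noncomputable instance (n : ℕ) : NormedSpace ℝ (SymMat n) :=
  inferInstanceAs (NormedSpace ℝ (symSubmodule n))

/-- The underlying matrix of an element of `𝕊ⁿ`. -/
def SymMat.toMatrix {n : ℕ} (M : SymMat n) : Matrix (Fin n) (Fin n) ℝ :=
  Subtype.val (p := fun A => A ∈ symSubmodule n) M

/-- The Gram matrix `U Uᵀ`, as an element of `𝕊ⁿ`. -/
def gramSym {n r : ℕ} (U : Matrix (Fin n) (Fin r) ℝ) : SymMat n :=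
  (⟨U * U.transpose, by
    change (U * U.transpose).transpose = U * U.transpose
    rw [Matrix.transpose_mul, Matrix.transpose_transpose]⟩ : symSubmodule n)

/-- The norm on `𝕊ⁿ` is the Frobenius norm, `‖E‖_F² = tr(Eᵀ E)`. -/
theorem SymMat.norm_sq_eq_trace {n : ℕ} (E : SymMat n) :
    ‖E‖ ^ 2 = (E.toMatrix.transpose * E.toMatrix).trace := by
  change ‖E.toMatrix‖ ^ 2 = _
  rw [Matrix.frobenius_norm_def, ← Real.sqrt_eq_rpow, Real.sq_sqrt (by positivity)]
  simp only [Matrix.trace, Matrix.diag_apply, Matrix.mul_apply, Matrix.transpose_apply, ← sq,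
    Real.norm_eq_abs, Real.rpow_ofNat, sq_abs]
  rw [Finset.sum_comm]

/-- `⟨∇²g(x)[v], v⟩`, the quadratic form of the second Fréchet derivative of `g` at `x`. -/
noncomputable def hessianForm {E : Type*} [NormedAddCommGroup E] [NormedSpace ℝ E]
    (g : E → ℝ) (x v : E) : ℝ :=
  fderiv ℝ (fderiv ℝ g) x v v

/-- `g` has a second Fréchet derivative at every point. -/
def TwiceDifferentiable {E : Type*} [NormedAddCommGroup E] [NormedSpace ℝ E]
    (g : E → ℝ) : Prop :=
  Differentiable ℝ g ∧ Differentiable ℝ (fderiv ℝ g)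

/-- `L`-smoothness of a twice-differentiable function:
`⟨∇²φ(M)[E], E⟩ ≤ L ‖E‖_F²` for all symmetric `M`, `E`. -/
def IsSmoothWith {n : ℕ} (φ : SymMat n → ℝ) (L : ℝ) : Prop :=
  ∀ M E : SymMat n, hessianForm φ M E ≤ L * ‖E‖ ^ 2

/-- `μ`-strong convexity of a twice-differentiable function:
`μ ‖E‖_F² ≤ ⟨∇²φ(M)[E], E⟩` for all symmetric `M`, `E`. -/
def IsStronglyConvexWith {n : ℕ} (φ : SymMat n → ℝ) (μ : ℝ) : Prop :=
  ∀ M E : SymMat n, μ * ‖E‖ ^ 2 ≤ hessianForm φ M E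

/-- `M` is a minimizer of `φ` over the positive semidefinite cone. -/
def IsPSDMinimizer {n : ℕ} (φ : SymMat n → ℝ) (M : SymMat n) : Prop :=
  M.toMatrix.PosSemidef ∧ ∀ N : SymMat n, N.toMatrix.PosSemidef → φ M ≤ φ N

/-- The Burer–Monteiro function `f(U) = φ(U Uᵀ)` on `n × r` matrices. -/
noncomputable def burerMonteiro {n : ℕ} (φ : SymMat n → ℝ) (r : ℕ)
    (U : Matrix (Fin n) (Fin r) ℝ) : ℝ :=
  φ (gramSym U)

/-- `∇f(X) = 0` and `∇²f(X) ⪰ 0`. -/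
def IsSecondOrderPoint {E : Type*} [NormedAddCommGroup E] [NormedSpace ℝ E]
    (f : E → ℝ) (X : E) : Prop :=
  fderiv ℝ f X = 0 ∧ ∀ V : E, 0 ≤ hessianForm f X V

/-- No spurious local minima: `min f` is attained, and
`∇f(X) = 0, ∇²f(X) ⪰ 0 ⟺ f(X) = min f`. -/
def NoSpuriousLocalMinima {E : Type*} [NormedAddCommGroup E] [NormedSpace ℝ E]
    (f : E → ℝ) : Prop :=
  (∃ U, IsMinOn f Set.univ U) ∧
    ∀ X, IsSecondOrderPoint f X ↔ IsMinOn f Set.univ X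

open Matrix

/-! Positive half. Let `s`, `t` be the gradients of `φ` at `X Xᵀ` and at the minimizer `Z Zᵀ`, and
`E = X Xᵀ - Z Zᵀ`. A second order point satisfies `s X = 0`, and `s` is bounded below by `-L lam` on
vectors orthogonal to a shortest singular direction of `X`, where `lam` is the least eigenvalue of
`Xᵀ X`. Optimality gives `t ⪰ 0` and `t E ≥ 0`. `cocoercive_dual` links `s` and `t` through a free
symmetric matrix `T`, chosen positive semidefinite on the part `P` of `Z` orthogonal to the range of
`X`. The result is an upper bound for `‖E‖²`, while `le_trace_sq_gram_sub_gram` gives a lower bound.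
Both are sums over the eigenvalues `ν` of `Pᵀ P`, so they are compared one eigenvalue at a time by
`exists_scalar_multipliers`. They conflict unless `P = 0`, and then `E = 0`; this is
`gram_eq_gram_of_secondOrder`.

Negative half. A quadratic whose Hessian is `3μ` except for the value `μ` in one direction has a
spurious point: `X` spans `r` coordinate axes, and the minimizer trades one of them for a new axis
with weight 2. -/

/-! ### The scalar inequality that decides the threshold 3. -/

/-- Each side is optimized separately: `τ = L lam / ν`, capped at `(L + μ) / 2`, minimizes the left
side, and `f = min lam ν` maximizes the right side. -/
theorem exists_scalar_multipliers {L μ lam : ℝ} (hμ : 0 < μ) (hμL : μ < L) (hL : L < 3 * μ)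
    (hlam : 0 < lam) (ν : ℝ) (hν : 0 ≤ ν) :
    ∃ f τ : ℝ, 0 ≤ f ∧ f ≤ ν ∧ 0 ≤ τ ∧ 2 * τ ≤ L + μ ∧
      L * lam * ((L + μ - 2 * τ) * ν) + τ ^ 2 * ν ^ 2 ≤
        μ * L * (ν ^ 2 + 2 * lam * f - f ^ 2) ∧
      (0 < ν → L * lam * ((L + μ - 2 * τ) * ν) + τ ^ 2 * ν ^ 2 <
        μ * L * (ν ^ 2 + 2 * lam * f - f ^ 2)) := by
  have hL0 : 0 < L := hμ.trans hμL
  rcases hν.eq_or_lt with rfl | hν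
  · exact ⟨0, 0, by simp [hL0.le, hμ.le, add_nonneg]⟩
  suffices h : ∃ f τ : ℝ, 0 ≤ f ∧ f ≤ ν ∧ 0 ≤ τ ∧ 2 * τ ≤ L + μ ∧
      L * lam * ((L + μ - 2 * τ) * ν) + τ ^ 2 * ν ^ 2 <
        μ * L * (ν ^ 2 + 2 * lam * f - f ^ 2) by
    obtain ⟨f, τ, h1, h2, h3, h4, h5⟩ := h
    exact ⟨f, τ, h1, h2, h3, h4, h5.le, fun _ => h5⟩
  rcases le_total (2 * L * lam) ((L + μ) * ν) with h | h
  · refine ⟨lam, L * lam / ν, hlam.le, ?_, by positivity, ?_, ?_⟩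
    · by_contra! hc
      nlinarith [mul_pos (sub_pos.2 hμL) hν, mul_pos hL0 (sub_pos.2 hc)]
    · rw [← mul_div_assoc, div_le_iff₀ hν]; linarith
    · have e1 : L * lam * ((L + μ - 2 * (L * lam / ν)) * ν) + (L * lam / ν) ^ 2 * ν ^ 2 =
          L * (lam * (L + μ) * ν - L * lam ^ 2) := by field_simp; ring
      rw [e1, mul_comm μ L, mul_assoc L μ]
      refine mul_lt_mul_of_pos_left ?_ hL0
      -- Completing the square leaves `(L + μ) (3μ - L) lam²`. At `L = 3μ` this vanishes and
      -- equality occurs at `ν = 2 lam`, the ratio used in the counterexample.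
      have : 0 < 4 * μ * (μ * ν ^ 2 - (L + μ) * lam * ν + (L + μ) * lam ^ 2) := by
        have : 0 < lam ^ 2 * ((L + μ) * (3 * μ - L)) := by
          have := sub_pos.2 hL; positivity
        nlinarith [sq_nonneg (2 * μ * ν - (L + μ) * lam)]
      have := pos_of_mul_pos_right this (by positivity)
      nlinarith
  · rcases le_total ν lam with h' | h'
    · refine ⟨ν, (L + μ) / 2, hν.le, le_rfl, by positivity, by linarith, ?_⟩
      have h8 : (L + μ) ^ 2 < 8 * μ * L := by
        nlinarith [mul_nonneg (sub_pos.2 hμL).le (sub_pos.2 hL).le]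
      have : (L + μ) ^ 2 * ν ^ 2 < 8 * μ * L * (lam * ν) := by
        have h1 : ν ^ 2 ≤ lam * ν := by nlinarith
        have h2 : 0 < ν ^ 2 := by positivity
        calc (L + μ) ^ 2 * ν ^ 2 < 8 * μ * L * ν ^ 2 := mul_lt_mul_of_pos_right h8 h2
          _ ≤ _ := mul_le_mul_of_nonneg_left h1 (by positivity)
      nlinarith
    · refine ⟨lam, (L + μ) / 2, hlam.le, h', by positivity, by linarith, ?_⟩
      -- The two sides of the goal differ by `μ L lam² - (L - μ)² ν² / 4`.
      have h1 : (L - μ) * ν ≤ L * lam := by nlinarith [mul_pos (sub_pos.2 hL) hν]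
      have h2 : ((L - μ) * ν) ^ 2 ≤ (L * lam) ^ 2 :=
        pow_le_pow_left₀ (mul_nonneg (sub_pos.2 hμL).le hν.le) h1 2
      have h3 : (L * lam) ^ 2 < 4 * μ * L * lam ^ 2 := by
        have : 0 < L * lam ^ 2 * (4 * μ - L) := by
          have : 0 < 4 * μ - L := by linarith
          positivity
        nlinarith
      nlinarith

/-! ### Orthogonal diagonalization and lower bounds for distances of Gram matrices. -/

theorem trace_transpose_mul_self_nonneg {m k : Type*} [Fintype m] [Fintype k]
    (A : Matrix m k ℝ) : 0 ≤ (Aᵀ * A).trace := by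
  simp only [trace, diag_apply, mul_apply, transpose_apply]
  exact Finset.sum_nonneg fun i _ => Finset.sum_nonneg fun j _ => mul_self_nonneg _

theorem transpose_mul_self_apply_nonneg {m k : Type*} [Fintype m] (W : Matrix m k ℝ)
    (j : k) : 0 ≤ (Wᵀ * W) j j := by
  simp only [mul_apply, transpose_apply]
  exact Finset.sum_nonneg fun i _ => mul_self_nonneg _

section Orthogonal

variable {m k : Type*} [Fintype m] [Fintype k] [DecidableEq k]

theorem Matrix.IsHermitian.exists_orthogonal_eq {A : Matrix k k ℝ} (hA : A.IsHermitian) :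
    ∃ R : Matrix k k ℝ, Rᵀ * R = 1 ∧ R * Rᵀ = 1 ∧ A = R * diagonal hA.eigenvalues * Rᵀ := by
  refine ⟨hA.eigenvectorUnitary, ?_, ?_, ?_⟩
  · simpa [star_eq_conjTranspose] using Unitary.coe_star_mul_self hA.eigenvectorUnitary
  · simpa [star_eq_conjTranspose] using Unitary.coe_mul_star_self hA.eigenvectorUnitary
  · have := hA.spectral_theorem
    rw [Unitary.conjStarAlgAut_apply] at this
    simpa [star_eq_conjTranspose, Function.comp_def] using this

theorem exists_orthogonal_diagonal {Q : Matrix k k ℝ} (hQ : Qᵀ = Q) :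
    ∃ (R : Matrix k k ℝ) (ν : k → ℝ), Rᵀ * R = 1 ∧ R * Rᵀ = 1 ∧ Rᵀ * Q * R = diagonal ν := by
  have hA : Q.IsHermitian := by simpa [Matrix.IsHermitian] using hQ
  obtain ⟨R, h1, h2, h3⟩ := hA.exists_orthogonal_eq
  refine ⟨R, hA.eigenvalues, h1, h2, ?_⟩
  calc Rᵀ * Q * R = Rᵀ * (R * diagonal hA.eigenvalues * Rᵀ) * R := by rw [← h3]
    _ = (Rᵀ * R) * diagonal hA.eigenvalues * (Rᵀ * R) := by simp only [Matrix.mul_assoc]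
    _ = _ := by rw [h1, Matrix.one_mul, Matrix.mul_one]

/-- The two products share their characteristic polynomial, hence their ordered eigenvalues, and `O`
carries one eigenbasis to the other. -/
theorem exists_orthogonal_transpose_mul_comm (W : Matrix k k ℝ) :
    ∃ O : Matrix k k ℝ, Oᵀ * O = 1 ∧ Oᵀ * (W * Wᵀ) * O = Wᵀ * W := by
  have hA : (W * Wᵀ).IsHermitian := by simpa using isHermitian_mul_conjTranspose_self W
  have hB : (Wᵀ * W).IsHermitian := by simpa using isHermitian_conjTranspose_mul_self W
  have he : hA.eigenvalues = hB.eigenvalues :=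
    (Matrix.IsHermitian.eigenvalues_eq_eigenvalues_iff hA hB).2 (Matrix.charpoly_mul_comm _ _)
  obtain ⟨R, h1, h2, h3⟩ := hA.exists_orthogonal_eq
  obtain ⟨S, k1, k2, k3⟩ := hB.exists_orthogonal_eq
  rw [he] at h3
  generalize hB.eigenvalues = e at h3 k3
  refine ⟨R * Sᵀ, ?_, ?_⟩
  · calc (R * Sᵀ)ᵀ * (R * Sᵀ) = S * (Rᵀ * R) * Sᵀ := by
          simp only [transpose_mul, transpose_transpose, Matrix.mul_assoc]
      _ = 1 := by rw [h1, Matrix.mul_one, k2]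
  · rw [h3, k3]
    calc (R * Sᵀ)ᵀ * (R * diagonal e * Rᵀ) * (R * Sᵀ)
        = S * (Rᵀ * R) * diagonal e * (Rᵀ * R) * Sᵀ := by
          simp only [transpose_mul, transpose_transpose, Matrix.mul_assoc]
      _ = _ := by simp only [h1, Matrix.mul_one]

theorem trace_mul_diagonal (A : Matrix k k ℝ) (f : k → ℝ) :
    (A * diagonal f).trace = ∑ j, A j j * f j := by
  simp [trace, mul_diagonal]

/-- A lower bound for the distance of a Gram matrix of a square matrix to a diagonal one. -/
theorem le_trace_sq_diagonal_sub_mul_transpose (W : Matrix k k ℝ) (d f : k → ℝ) {lam : ℝ}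
    (hd : ∀ j, lam ≤ d j) (hf : ∀ j, 0 ≤ f j) :
    ∑ j, (2 * lam * f j - f j ^ 2) - 2 * ∑ j, (Wᵀ * W) j j * f j ≤
      ((diagonal d - W * Wᵀ) * (diagonal d - W * Wᵀ)).trace := by
  obtain ⟨O, hO, hW⟩ := exists_orthogonal_transpose_mul_comm W
  obtain ⟨C, hC⟩ : ∃ C, C = diagonal d - W * Wᵀ := ⟨_, rfl⟩
  -- Test matrix for `‖C‖² ≥ 2⟨C, Y⟩ - ‖Y‖²`. Conjugation by `O` makes `⟨W Wᵀ, Y⟩` depend only on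
  -- the diagonal of `Wᵀ W`.
  obtain ⟨Y, hY⟩ : ∃ Y, Y = O * diagonal f * Oᵀ := ⟨_, rfl⟩
  rw [← hC]
  have hCt : Cᵀ = C := by simp [hC, transpose_sub]
  have hYt : Yᵀ = Y := by simp [hY, Matrix.mul_assoc]
  have h0 := trace_transpose_mul_self_nonneg (C - Y)
  have e0 : ((C - Y)ᵀ * (C - Y)).trace = (C * C).trace - 2 * (C * Y).trace + (Y * Y).trace := by
    rw [transpose_sub, hCt, hYt, Matrix.sub_mul, Matrix.mul_sub, Matrix.mul_sub, trace_sub,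
      trace_sub, trace_sub, trace_mul_comm Y C]
    ring
  have e1 : (Y * Y).trace = ∑ j, f j ^ 2 := by
    have : Y * Y = O * (diagonal f * (Oᵀ * O) * diagonal f * Oᵀ) := by
      simp only [hY, Matrix.mul_assoc]
    rw [this, trace_mul_comm, hO, Matrix.mul_one, Matrix.mul_assoc, hO, Matrix.mul_one,
      diagonal_mul_diagonal, trace_diagonal]
    simp only [sq]
  have e2 : (W * Wᵀ * Y).trace = ∑ j, (Wᵀ * W) j j * f j := by
    rw [← trace_mul_diagonal, ← hW, hY]
    rw [← Matrix.mul_assoc, trace_mul_comm]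
    simp only [Matrix.mul_assoc]
  have e3 : lam * ∑ j, f j ≤ (diagonal d * Y).trace := by
    have hYd : ∀ j, 0 ≤ Y j j := fun j => by
      rw [hY, mul_apply]
      refine Finset.sum_nonneg fun i _ => ?_
      rw [mul_diagonal, transpose_apply]
      nlinarith [mul_nonneg (hf i) (mul_self_nonneg (O j i))]
    have hYs : Y.trace = ∑ j, f j := by
      rw [hY, trace_mul_comm, ← Matrix.mul_assoc, hO, Matrix.one_mul, trace_diagonal]
    rw [← hYs, trace, trace, Finset.mul_sum]
    refine Finset.sum_le_sum fun j _ => ?_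
    simpa [diagonal_mul] using mul_le_mul_of_nonneg_right (hd j) (hYd j)
  have e4 : (C * Y).trace = (diagonal d * Y).trace - (W * Wᵀ * Y).trace := by
    rw [hC, Matrix.sub_mul, trace_sub]
  have e5 : ∑ j, (2 * lam * f j - f j ^ 2) = 2 * (lam * ∑ j, f j) - ∑ j, f j ^ 2 := by
    rw [Finset.sum_sub_distrib, Finset.mul_sum, Finset.mul_sum]
    simp only [mul_assoc]
  linarith

/-- A lower bound for the Frobenius distance of two Gram matrices, the second one split along
the column space of the first. -/
theorem le_trace_sq_gram_sub_gram {X Z : Matrix m k ℝ} {W : Matrix k k ℝ} {d ν f : k → ℝ} {lam : ℝ}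
    (hX : Xᵀ * X = 1) (hXZ : Xᵀ * Z = 0) (hZ : Zᵀ * Z = diagonal ν)
    (hd : ∀ j, lam ≤ d j) (hf : ∀ j, 0 ≤ f j) (hfν : ∀ j, f j ≤ ν j)
    {E : Matrix m m ℝ} (hE : E = X * diagonal d * Xᵀ - (X * W + Z) * (X * W + Z)ᵀ) :
    ∑ j, (ν j ^ 2 + 2 * lam * f j - f j ^ 2) ≤ (E * E).trace := by
  have hZX : Zᵀ * X = 0 := by rw [← transpose_transpose X, ← transpose_mul, hXZ, transpose_zero]
  obtain ⟨C, hC⟩ : ∃ C, C = diagonal d - W * Wᵀ := ⟨_, rfl⟩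
  have hE' : E = X * C * Xᵀ - X * W * Zᵀ - Z * Wᵀ * Xᵀ - Z * Zᵀ := by
    rw [hE, hC]
    simp only [transpose_add, transpose_mul, Matrix.mul_add, Matrix.add_mul, Matrix.mul_sub,
      Matrix.sub_mul, Matrix.mul_assoc]
    abel
  have hEX : E * X = X * C - Z * Wᵀ := by
    rw [hE']
    simp only [Matrix.sub_mul, Matrix.mul_assoc, hX, hZX, Matrix.mul_zero, Matrix.mul_one,
      sub_zero]
  have hEZ : E * Z = - (X * W * diagonal ν) - Z * diagonal ν := by
    rw [hE']
    simp only [Matrix.sub_mul, Matrix.mul_assoc, hXZ, hZ, Matrix.mul_zero, zero_sub, sub_zero]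
  -- Pythagoras for the blocks of `E` relative to the range of `X` and its complement.
  have hEE : (E * E).trace = (C * C).trace + 2 * (Wᵀ * W * diagonal ν).trace
      + (diagonal ν * diagonal ν).trace := by
    have t1 : (E * (X * C * Xᵀ)).trace = (C * C).trace := by
      rw [← Matrix.mul_assoc, ← Matrix.mul_assoc, hEX, trace_mul_comm, ← Matrix.mul_assoc,
        Matrix.mul_sub, ← Matrix.mul_assoc, ← Matrix.mul_assoc, hX, hXZ]
      simp
    have t2 : (E * (X * W * Zᵀ)).trace = - (Wᵀ * W * diagonal ν).trace := by
      rw [← Matrix.mul_assoc, ← Matrix.mul_assoc, hEX, trace_mul_comm, ← Matrix.mul_assoc,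
        Matrix.mul_sub, ← Matrix.mul_assoc, ← Matrix.mul_assoc, hZX, hZ]
      rw [Matrix.zero_mul, zero_sub, Matrix.neg_mul, trace_neg, Matrix.mul_assoc, trace_mul_comm]
    have t3 : (E * (Z * Wᵀ * Xᵀ)).trace = - (Wᵀ * W * diagonal ν).trace := by
      rw [← Matrix.mul_assoc, ← Matrix.mul_assoc, hEZ, trace_mul_comm, ← Matrix.mul_assoc,
        Matrix.mul_sub, Matrix.mul_neg, ← Matrix.mul_assoc, ← Matrix.mul_assoc,
        ← Matrix.mul_assoc, hX, hXZ]
      rw [Matrix.one_mul, Matrix.zero_mul, sub_zero, Matrix.neg_mul, trace_neg, trace_mul_comm,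
        ← Matrix.mul_assoc]
    have t4 : (E * (Z * Zᵀ)).trace = - (diagonal ν * diagonal ν).trace := by
      rw [← Matrix.mul_assoc, hEZ, trace_mul_comm,
        Matrix.mul_sub, Matrix.mul_neg, ← Matrix.mul_assoc, ← Matrix.mul_assoc,
        ← Matrix.mul_assoc, hZX, hZ]
      rw [Matrix.zero_mul, Matrix.zero_mul, neg_zero, zero_sub, trace_neg]
    have t5 : E * E = E * (X * C * Xᵀ) - E * (X * W * Zᵀ) - E * (Z * Wᵀ * Xᵀ) - E * (Z * Zᵀ) := by
      rw [← Matrix.mul_sub, ← Matrix.mul_sub, ← Matrix.mul_sub, ← hE']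
    rw [t5, trace_sub, trace_sub, trace_sub, t1, t2, t3, t4]
    ring
  have h1 := le_trace_sq_diagonal_sub_mul_transpose W d f hd hf
  rw [← hC] at h1
  rw [hEE, trace_mul_diagonal, diagonal_mul_diagonal, trace_diagonal]
  -- The off-diagonal blocks pay for the `W`-dependent loss in `h1`; this is where `f ≤ ν` enters.
  have h2 : ∑ j, (Wᵀ * W) j j * f j ≤ ∑ j, (Wᵀ * W) j j * ν j :=
    Finset.sum_le_sum fun j _ =>
      mul_le_mul_of_nonneg_left (hfν j) (transpose_mul_self_apply_nonneg W j)
  have h3 : ∑ j, (ν j ^ 2 + 2 * lam * f j - f j ^ 2) =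
      ∑ j, ν j * ν j + ∑ j, (2 * lam * f j - f j ^ 2) := by
    rw [← Finset.sum_add_distrib]
    exact Finset.sum_congr rfl fun j _ => by ring
  linarith

end Orthogonal

/-! ### From second order conditions to equality of Gram matrices. -/

theorem mul_diagonal_mul_transpose_eq_sum {m k : Type*} [Fintype k] [DecidableEq k]
    (A : Matrix m k ℝ) (g : k → ℝ) :
    A * diagonal g * Aᵀ = ∑ j, g j • vecMulVec (A.col j) (A.col j) := by
  ext a b
  rw [mul_apply]
  simp only [mul_diagonal, transpose_apply, Matrix.sum_apply, Matrix.smul_apply, vecMulVec_apply,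
    col_apply, smul_eq_mul]
  exact Finset.sum_congr rfl fun j _ => by ring

theorem trace_sq_vecMulVec_add {m : Type*} [Fintype m] {x y : m → ℝ} (h : x ⬝ᵥ y = 0) :
    ((vecMulVec x y + vecMulVec y x) * (vecMulVec x y + vecMulVec y x)).trace =
      2 * ((x ⬝ᵥ x) * (y ⬝ᵥ y)) := by
  have h' : y ⬝ᵥ x = 0 := by rw [dotProduct_comm, h]
  rw [Matrix.add_mul, Matrix.mul_add, Matrix.mul_add]
  simp only [vecMulVec_mul_vecMulVec, trace_add, trace_vecMulVec, h, h',
    smul_eq_mul, dotProduct_smul]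
  ring

/-- A second order point of a Burer–Monteiro function, in terms of the two gradients `s` (at the
Gram matrix of the point) and `t` (at the minimizer), gives the minimizer. -/
theorem gram_eq_gram_of_secondOrder {m k : Type*} [Fintype m] [Fintype k] [DecidableEq k]
    {L μ : ℝ} (hμ : 0 < μ) (hμL : μ < L) (hL : L < 3 * μ)
    (X Z : Matrix m k ℝ) (s t : Matrix m m ℝ →ₗ[ℝ] ℝ) (hsT : ∀ A, s Aᵀ = s A)
    (h1 : ∀ V : Matrix m k ℝ, s (X * Vᵀ) = 0)
    (h2 : ∀ V : Matrix m k ℝ,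
      0 ≤ 2 * s (V * Vᵀ) + L * ((X * Vᵀ + V * Xᵀ) * (X * Vᵀ + V * Xᵀ)).trace)
    (ht : ∀ V : Matrix m k ℝ, 0 ≤ t (V * Vᵀ))
    {E : Matrix m m ℝ} (hE : E = X * Xᵀ - Z * Zᵀ) (htE : 0 ≤ t E)
    (h4 : ∀ T : Matrix m m ℝ, Tᵀ = T →
      0 ≤ (L + μ) * (s E - t E) + 2 * (s T - t T) + (T * T).trace - μ * L * (E * E).trace) :
    X * Xᵀ = Z * Zᵀ := by
  rcases isEmpty_or_nonempty k with hk | hk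
  · rw [Subsingleton.elim X Z]
  have hL0 : 0 < L := hμ.trans hμL
  have hET : Eᵀ = E := by simp [hE, transpose_sub]
  have hsXX : s (X * Xᵀ) = 0 := h1 X
  have hsE : s E = - s (Z * Zᵀ) := by rw [hE, map_sub, hsXX, zero_sub]
  -- With `T = 0`, cocoercivity bounds `μ L ‖E‖²` by `(L + μ)(s E - t E)`, where `s E = -s (Z Zᵀ)`
  -- and `t E ≥ 0`.
  have key : 0 ≤ s (Z * Zᵀ) → X * Xᵀ = Z * Zᵀ := fun hs => by
    have h0 := h4 0 (by simp)
    simp only [map_zero, Matrix.mul_zero, trace_zero] at h0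
    have hle : (Eᵀ * E).trace ≤ 0 := by
      rw [hET]
      have : (L + μ) * (s E - t E) ≤ 0 :=
        mul_nonpos_of_nonneg_of_nonpos (by positivity) (by linarith)
      have hμL' : 0 < μ * L := mul_pos hμ hL0
      by_contra! hc
      nlinarith [mul_pos hμL' hc]
    have h00 : (Eᴴ * E).trace = 0 := by
      simpa using le_antisymm hle (trace_transpose_mul_self_nonneg E)
    have := trace_conjTranspose_mul_self_eq_zero_iff.1 h00
    rwa [hE, sub_eq_zero] at this
  -- A rotation of the factor makes its columns orthogonal without changing `X Xᵀ`.
  obtain ⟨R, d, hR, hR', hd⟩ := exists_orthogonal_diagonal (Q := Xᵀ * X) (by simp)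
  obtain ⟨Y, hY⟩ : ∃ Y, Y = X * R := ⟨_, rfl⟩
  have hYY : Yᵀ * Y = diagonal d := by
    rw [← hd, hY, transpose_mul]; simp only [Matrix.mul_assoc]
  have hXY : X * Xᵀ = Y * Yᵀ := by
    rw [hY, transpose_mul, Matrix.mul_assoc, ← Matrix.mul_assoc R, hR', Matrix.one_mul]
  have hsY : ∀ V : Matrix m k ℝ, s (Y * Vᵀ) = 0 := fun V => by
    have := h1 (V * Rᵀ)
    rwa [transpose_mul, transpose_transpose, ← Matrix.mul_assoc, ← hY] at this
  have hdj : ∀ j, Y.col j ⬝ᵥ Y.col j = d j := fun j => by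
    have := congr_fun (congr_fun hYY j) j
    rw [diagonal_apply_eq] at this
    rw [← this]; rfl
  -- The curvature condition is tested on `V = y eⱼᵀ Rᵀ`, which moves only column `j` of `Y`, in the
  -- direction `y`.
  have hcurv : ∀ (j : k) (y : m → ℝ), Y.col j ⬝ᵥ y = 0 →
      - (L * d j * (y ⬝ᵥ y)) ≤ s (vecMulVec y y) := fun j y hy => by
    have e1 : Y * (vecMulVec y (Pi.single j 1))ᵀ = vecMulVec (Y.col j) y := by
      ext a b
      simp [mul_apply, vecMulVec_apply, Pi.single_apply]
    have := h2 (vecMulVec y (Pi.single j 1) * Rᵀ)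
    have e2 : X * (vecMulVec y (Pi.single j 1) * Rᵀ)ᵀ = vecMulVec (Y.col j) y := by
      rw [transpose_mul, transpose_transpose, ← Matrix.mul_assoc, ← hY, e1]
    have e3 : vecMulVec y (Pi.single j 1) * Rᵀ * Xᵀ = vecMulVec y (Y.col j) := by
      rw [← transpose_transpose (vecMulVec y (Pi.single j 1) * Rᵀ), ← transpose_mul, e2,
        transpose_vecMulVec]
    have e4 : vecMulVec y (Pi.single j 1) * Rᵀ * (vecMulVec y (Pi.single j 1) * Rᵀ)ᵀ =
        vecMulVec y y := by
      rw [transpose_mul, transpose_transpose, Matrix.mul_assoc, ← Matrix.mul_assoc Rᵀ, hR,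
        Matrix.one_mul]
      ext a b
      simp [mul_apply, vecMulVec_apply, Pi.single_apply]
    rw [e2, e3, e4, trace_sq_vecMulVec_add hy, hdj] at this
    linarith
  obtain ⟨j₀, hj₀⟩ := Finite.exists_min d
  have hd0 : 0 ≤ d j₀ := by
    simpa [hYY] using transpose_mul_self_apply_nonneg Y j₀
  rcases hd0.eq_or_lt with hd0 | hlam
  -- A zero column is free to move in every direction at no cost, so `s ⪰ 0` and `key` applies.
  · have hcol : Y.col j₀ = 0 := dotProduct_self_eq_zero.1 ((hdj j₀).trans hd0.symm)
    apply key
    have hZ := mul_diagonal_mul_transpose_eq_sum Z fun _ => 1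
    rw [show (diagonal fun _ => 1 : Matrix k k ℝ) = 1 from diagonal_one, Matrix.mul_one] at hZ
    rw [hZ, map_sum]
    refine Finset.sum_nonneg fun j _ => ?_
    have := hcurv j₀ (Z.col j) (by rw [hcol, zero_dotProduct])
    simpa [← hd0] using this
  obtain ⟨lam, hlamd⟩ : ∃ lam, lam = d j₀ := ⟨_, rfl⟩
  rw [← hlamd] at hlam
  have hlamle : ∀ j, lam ≤ d j := fun j => hlamd ▸ hj₀ j
  have hdpos : ∀ j, 0 < d j := fun j => hlam.trans_le (hlamle j)
  obtain ⟨B, hB⟩ : ∃ B, B = Y * diagonal (fun j => (√(d j))⁻¹) := ⟨_, rfl⟩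
  have hBB : Bᵀ * B = 1 := by
    rw [hB, transpose_mul, diagonal_transpose, Matrix.mul_assoc, ← Matrix.mul_assoc Yᵀ, hYY,
      diagonal_mul_diagonal, diagonal_mul_diagonal, ← diagonal_one]
    congr 1; ext j
    have := Real.sqrt_pos.2 (hdpos j)
    field_simp
    exact (Real.sq_sqrt (hdpos j).le).symm
  have hYB : Y * Yᵀ = B * diagonal d * Bᵀ := by
    have : diagonal (fun j => (√(d j))⁻¹) * diagonal d * diagonal (fun j => (√(d j))⁻¹) =
        (1 : Matrix k k ℝ) := by
      rw [diagonal_mul_diagonal, diagonal_mul_diagonal, ← diagonal_one]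
      congr 1; ext j
      have := Real.sqrt_pos.2 (hdpos j)
      field_simp
      exact (Real.sq_sqrt (hdpos j).le).symm
    calc Y * Yᵀ = Y * (diagonal (fun j => (√(d j))⁻¹) * diagonal d *
          diagonal (fun j => (√(d j))⁻¹)) * Yᵀ := by rw [this, Matrix.mul_one]
      _ = _ := by
        rw [hB, transpose_mul, diagonal_transpose]
        simp only [Matrix.mul_assoc]
  have hsB : ∀ V : Matrix m k ℝ, s (B * Vᵀ) = 0 := fun V => by
    have := hsY (V * diagonal (fun j => (√(d j))⁻¹))
    rwa [transpose_mul, diagonal_transpose, ← Matrix.mul_assoc, ← hB] at this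
  obtain ⟨N, hN⟩ : ∃ N, N = Z - B * (Bᵀ * Z) := ⟨_, rfl⟩
  have hBN : Bᵀ * N = 0 := by
    rw [hN, Matrix.mul_sub, ← Matrix.mul_assoc, hBB, Matrix.one_mul, sub_self]
  obtain ⟨O, ν, hO, hO', hν⟩ := exists_orthogonal_diagonal (Q := Nᵀ * N) (by simp)
  obtain ⟨W, hW⟩ : ∃ W, W = Bᵀ * Z * O := ⟨_, rfl⟩
  obtain ⟨P, hP⟩ : ∃ P, P = N * O := ⟨_, rfl⟩
  have hBP : Bᵀ * P = 0 := by rw [hP, ← Matrix.mul_assoc, hBN, Matrix.zero_mul]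
  have hPP : Pᵀ * P = diagonal ν := by
    rw [← hν, hP, transpose_mul]; simp only [Matrix.mul_assoc]
  have hZO : B * W + P = Z * O := by
    rw [hW, hP, hN, Matrix.sub_mul]; simp only [Matrix.mul_assoc]; abel
  have hZZ : Z * Zᵀ = (B * W + P) * (B * W + P)ᵀ := by
    rw [hZO, transpose_mul, Matrix.mul_assoc, ← Matrix.mul_assoc O, hO', Matrix.one_mul]
  -- Every term with a factor `B` at one end is annihilated by `s`.
  have hsZ : s (Z * Zᵀ) = s (P * Pᵀ) := by
    have : Z * Zᵀ = B * ((B * W + P) * Wᵀ)ᵀ + (B * (P * Wᵀ)ᵀ)ᵀ + P * Pᵀ := by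
      rw [hZZ]
      simp only [transpose_add, transpose_mul, transpose_transpose, Matrix.mul_add,
        Matrix.add_mul, Matrix.mul_assoc]
      abel
    rw [this, map_add, map_add, hsT, hsB, hsB, zero_add, zero_add]
  have hνj : ∀ j, P.col j ⬝ᵥ P.col j = ν j := fun j => by
    have := congr_fun (congr_fun hPP j) j
    rw [diagonal_apply_eq] at this
    rw [← this]; rfl
  have hν0 : ∀ j, 0 ≤ ν j := fun j => by
    simpa [hPP] using transpose_mul_self_apply_nonneg P j
  have hYP : Yᵀ * P = 0 := by
    have : Yᵀ = diagonal (fun j => √(d j)) * Bᵀ := by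
      rw [hB, transpose_mul, diagonal_transpose, ← Matrix.mul_assoc, diagonal_mul_diagonal]
      have : (fun j => √(d j) * (√(d j))⁻¹) = fun _ => 1 := by
        ext j
        exact mul_inv_cancel₀ (Real.sqrt_pos.2 (hdpos j)).ne'
      rw [this, diagonal_one, Matrix.one_mul]
    rw [this, Matrix.mul_assoc, hBP, Matrix.mul_zero]
  have hsP : ∀ g : k → ℝ, (∀ j, 0 ≤ g j) →
      - ∑ j, L * lam * (g j * ν j) ≤ s (P * diagonal g * Pᵀ) := fun g hg => by
    rw [mul_diagonal_mul_transpose_eq_sum, map_sum, ← Finset.sum_neg_distrib]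
    refine Finset.sum_le_sum fun j _ => ?_
    have h := hcurv j₀ (P.col j) (by
      have := congr_fun (congr_fun hYP j₀) j
      exact this)
    rw [hνj, ← hlamd] at h
    rw [map_smul, smul_eq_mul]
    have := mul_le_mul_of_nonneg_left h (hg j)
    linarith
  choose f τ hf hfν hτ hτK hle hlt using
    fun j => exists_scalar_multipliers hμ hμL hL hlam (ν j) (hν0 j)
  -- `0 ≤ τ` makes `T ⪰ 0`, so `t T` can be dropped; `2 τ ≤ L + μ` keeps the weights `L + μ - 2 τ`
  -- nonnegative, as the lower bound `hsP` requires.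
  obtain ⟨T, hT⟩ : ∃ T, T = P * diagonal τ * Pᵀ := ⟨_, rfl⟩
  have hTT : Tᵀ = T := by simp [hT, Matrix.mul_assoc]
  have htT : 0 ≤ t T := by
    have := ht (P * diagonal (fun j => √(τ j)))
    rw [transpose_mul, diagonal_transpose, Matrix.mul_assoc, ← Matrix.mul_assoc (diagonal _),
      diagonal_mul_diagonal] at this
    simp only [Real.mul_self_sqrt (hτ _)] at this
    rwa [← Matrix.mul_assoc, ← hT] at this
  have htr : (T * T).trace = ∑ j, τ j ^ 2 * ν j ^ 2 := by
    have : T * T = P * (diagonal τ * (Pᵀ * P) * diagonal τ * Pᵀ) := by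
      simp only [hT, Matrix.mul_assoc]
    rw [this, trace_mul_comm, Matrix.mul_assoc, hPP, diagonal_mul_diagonal, diagonal_mul_diagonal,
      diagonal_mul_diagonal, trace_diagonal]
    exact Finset.sum_congr rfl fun j _ => by ring
  have hEE : ∑ j, (ν j ^ 2 + 2 * lam * f j - f j ^ 2) ≤ (E * E).trace :=
    le_trace_sq_gram_sub_gram hBB hBP hPP hlamle hf hfν (by rw [hE, hXY, hYB, hZZ])
  have hsK : s (P * diagonal (fun j => L + μ - 2 * τ j) * Pᵀ) =
      (L + μ) * s (P * Pᵀ) - 2 * s T := by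
    have : (diagonal (fun j => L + μ - 2 * τ j) : Matrix k k ℝ) =
        (L + μ) • 1 - (2 : ℝ) • diagonal τ := by
      rw [← diagonal_one, ← diagonal_smul, ← diagonal_smul, diagonal_sub]
      congr 1; ext j; simp
    rw [this, Matrix.mul_sub, Matrix.sub_mul, Matrix.mul_smul, Matrix.mul_smul, Matrix.smul_mul,
      Matrix.smul_mul, Matrix.mul_one, ← hT, map_sub, map_smul, map_smul, smul_eq_mul, smul_eq_mul]
  have hmain := h4 T hTT
  have hsP' := hsP (fun j => L + μ - 2 * τ j) fun j => sub_nonneg.2 (hτK j)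
  rw [hsK] at hsP'
  rw [hsE, hsZ] at hmain
  have hsum : ∑ j, μ * L * (ν j ^ 2 + 2 * lam * f j - f j ^ 2) ≤
      ∑ j, (L * lam * ((L + μ - 2 * τ j) * ν j) + τ j ^ 2 * ν j ^ 2) := by
    rw [Finset.sum_add_distrib, ← htr, ← Finset.mul_sum]
    have := mul_le_mul_of_nonneg_left hEE (mul_pos hμ hL0).le
    have := mul_nonneg (add_pos hL0 hμ).le htE
    linarith
  have hν00 : ν = 0 := by
    by_contra hne
    obtain ⟨j, hj⟩ := Function.ne_iff.1 hne
    exact hsum.not_gt (Finset.sum_lt_sum (fun i _ => hle i)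
      ⟨j, Finset.mem_univ j, hlt j ((hν0 j).lt_of_ne' hj)⟩)
  apply key
  rw [hsZ]
  have hP0 : P = 0 := by
    refine trace_conjTranspose_mul_self_eq_zero_iff.1 ?_
    rw [conjTranspose_eq_transpose_of_trivial, hPP, hν00]
    simp
  simp [hP0]

/-! ### Symmetric matrices and the Gram map as a quadratic map. -/

/-- The symmetric part `½ (A + Aᵀ)` of a square matrix. -/
noncomputable def symPart (n : ℕ) : Matrix (Fin n) (Fin n) ℝ →ₗ[ℝ] SymMat n where
  toFun A := (⟨(1 / 2 : ℝ) • (A + Aᵀ), by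
    change ((1 / 2 : ℝ) • (A + Aᵀ))ᵀ = _
    rw [transpose_smul, transpose_add, transpose_transpose, add_comm]⟩ : symSubmodule n)
  map_add' A B := Subtype.ext (by
    change (1 / 2 : ℝ) • (A + B + (A + B)ᵀ) = (1 / 2 : ℝ) • (A + Aᵀ) + (1 / 2 : ℝ) • (B + Bᵀ)
    rw [transpose_add, ← smul_add]; congr 1; abel)
  map_smul' c A := Subtype.ext (by
    change (1 / 2 : ℝ) • (c • A + (c • A)ᵀ) = c • ((1 / 2 : ℝ) • (A + Aᵀ))
    rw [transpose_smul, ← smul_add, smul_comm])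

theorem SymMat.toMatrix_injective {n : ℕ} : Function.Injective (SymMat.toMatrix (n := n)) :=
  Subtype.val_injective

theorem toMatrix_symPart {n : ℕ} (A : Matrix (Fin n) (Fin n) ℝ) :
    (symPart n A).toMatrix = (1 / 2 : ℝ) • (A + Aᵀ) := rfl

theorem SymMat.transpose_toMatrix {n : ℕ} (M : SymMat n) : M.toMatrixᵀ = M.toMatrix := M.2

theorem symPart_toMatrix {n : ℕ} (M : SymMat n) : symPart n M.toMatrix = M := by
  apply SymMat.toMatrix_injective
  rw [toMatrix_symPart, M.transpose_toMatrix, ← two_smul ℝ, smul_smul]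
  norm_num

theorem symPart_transpose {n : ℕ} (A : Matrix (Fin n) (Fin n) ℝ) :
    symPart n Aᵀ = symPart n A := by
  apply SymMat.toMatrix_injective
  rw [toMatrix_symPart, toMatrix_symPart, transpose_transpose, add_comm]

theorem gramSym_eq_symPart {n r : ℕ} (U : Matrix (Fin n) (Fin r) ℝ) :
    gramSym U = symPart n (U * Uᵀ) := (symPart_toMatrix (gramSym U)).symm

theorem toMatrix_gramSym {n r : ℕ} (U : Matrix (Fin n) (Fin r) ℝ) :
    (gramSym U).toMatrix = U * Uᵀ := rfl

theorem posSemidef_gramSym {n r : ℕ} (U : Matrix (Fin n) (Fin r) ℝ) :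
    (gramSym U).toMatrix.PosSemidef := by
  simpa [toMatrix_gramSym] using posSemidef_self_mul_conjTranspose U

theorem SymMat.norm_sq_eq {n : ℕ} (E : SymMat n) : ‖E‖ ^ 2 = (E.toMatrix * E.toMatrix).trace := by
  rw [SymMat.norm_sq_eq_trace, E.transpose_toMatrix]

instance (n : ℕ) : FiniteDimensional ℝ (SymMat n) :=
  inferInstanceAs (FiniteDimensional ℝ (symSubmodule n))

/-- The symmetric bilinear map `(U, V) ↦ ½ (U Vᵀ + V Uᵀ)`, whose diagonal is the Gram matrix. -/
noncomputable def gramBilin (n r : ℕ) :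
    Matrix (Fin n) (Fin r) ℝ →ₗ[ℝ] Matrix (Fin n) (Fin r) ℝ →ₗ[ℝ] SymMat n :=
  LinearMap.mk₂ ℝ (fun U V => symPart n (U * Vᵀ))
    (fun U U' V => by rw [Matrix.add_mul, map_add])
    (fun c U V => by rw [Matrix.smul_mul, map_smul])
    (fun U V V' => by rw [transpose_add, Matrix.mul_add, map_add])
    (fun c U V => by rw [transpose_smul, Matrix.mul_smul, map_smul])

theorem gramBilin_apply {n r : ℕ} (U V : Matrix (Fin n) (Fin r) ℝ) :
    gramBilin n r U V = symPart n (U * Vᵀ) := rfl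

theorem gramBilin_comm {n r : ℕ} (U V : Matrix (Fin n) (Fin r) ℝ) :
    gramBilin n r U V = gramBilin n r V U := by
  rw [gramBilin_apply, gramBilin_apply, ← symPart_transpose, transpose_mul, transpose_transpose]

/-! ### Second order calculus of a function composed with a quadratic map. -/

/-- The second order necessary condition for a minimum. -/
theorem IsMinOn.isSecondOrderPoint {E : Type*} [NormedAddCommGroup E] [NormedSpace ℝ E]
    {f : E → ℝ} {x : E} (h : IsMinOn f Set.univ x) (hf : Differentiable ℝ f)
    (hf' : DifferentiableAt ℝ (fderiv ℝ f) x) : IsSecondOrderPoint f x := by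
  have hmin : IsLocalMin f x := h.isLocalMin Filter.univ_mem
  refine ⟨hmin.fderiv_eq_zero, fun v => ?_⟩
  by_contra! hneg
  have hline : ∀ t : ℝ, HasDerivAt (fun t : ℝ => x + t • v) v t := fun t => by
    simpa using ((hasDerivAt_id t).smul_const v).const_add x
  have h1 : ∀ t : ℝ, HasDerivAt (fun t : ℝ => f (x + t • v)) (fderiv ℝ f (x + t • v) v) t :=
    fun t => (hf _).hasFDerivAt.comp_hasDerivAt t (hline t)
  have h2 : HasDerivAt (fun t : ℝ => fderiv ℝ f (x + t • v) v) (hessianForm f x v) 0 := by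
    have hx : DifferentiableAt ℝ (fderiv ℝ f) (x + (0 : ℝ) • v) := by simpa using hf'
    have h : HasDerivAt (fun t : ℝ => fderiv ℝ f (x + t • v))
        (fderiv ℝ (fderiv ℝ f) (x + (0 : ℝ) • v) v) 0 :=
      hx.hasFDerivAt.comp_hasDerivAt (f := fun t : ℝ => x + t • v) 0 (hline 0)
    simpa [hessianForm] using h.clm_apply (hasDerivAt_const 0 v)
  have hd : deriv (fun t : ℝ => f (x + t • v)) = fun t => fderiv ℝ f (x + t • v) v :=
    funext fun t => (h1 t).deriv
  have hdd : deriv (deriv (fun t : ℝ => f (x + t • v))) 0 = hessianForm f x v := by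
    rw [hd, h2.deriv]
  -- Negative curvature would make 0 a local maximum along the line as well as a minimum. The
  -- function would then be locally constant, with second derivative 0.
  have hmax : IsLocalMin (fun t : ℝ => - f (x + t • v)) 0 := by
    have hdn : deriv (fun t : ℝ => - f (x + t • v)) = fun t => - fderiv ℝ f (x + t • v) v :=
      funext fun t => (h1 t).neg.deriv
    refine isLocalMin_of_deriv_deriv_pos ?_ ?_ (h1 0).neg.continuousAt
    · rw [hdn, h2.fun_neg.deriv]; linarith
    · rw [hdn]; simp [hmin.fderiv_eq_zero]
  have hconst : (fun t : ℝ => f (x + t • v)) =ᶠ[nhds 0] fun _ => f x := by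
    filter_upwards [hmax] with t ht
    have := h (Set.mem_univ (x + t • v))
    simp only [Set.mem_ofPred_eq, zero_smul, add_zero] at this ht
    linarith
  have h0 : deriv (deriv (fun t : ℝ => f (x + t • v))) 0 = 0 := by
    rw [hconst.deriv.deriv_eq]; simp
  rw [hdd] at h0
  exact hneg.ne h0

section Quadratic

variable {E F : Type*} [NormedAddCommGroup E] [NormedSpace ℝ E]
  [NormedAddCommGroup F] [NormedSpace ℝ F] {φ : F → ℝ} {B : E →L[ℝ] E →L[ℝ] F}

theorem hasFDerivAt_quadratic (hB : ∀ x y, B x y = B y x) (x : E) :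
    HasFDerivAt (fun x => B x x) ((2 : ℝ) • B x) x := by
  have h : HasFDerivAt (fun y => B y y) _ x := B.hasFDerivAt.clm_apply (hasFDerivAt_id x)
  refine h.congr_fderiv (ContinuousLinearMap.ext fun v => ?_)
  simp [two_smul, hB v x]

theorem hasFDerivAt_comp_quadratic (hφ : Differentiable ℝ φ) (hB : ∀ x y, B x y = B y x) (x : E) :
    HasFDerivAt (fun x => φ (B x x)) ((fderiv ℝ φ (B x x)).comp ((2 : ℝ) • B x)) x :=
  (hφ (B x x)).hasFDerivAt.comp (f := fun x => B x x) x (hasFDerivAt_quadratic hB x)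

/-- The second derivative of a function of a quadratic map. -/
theorem exists_hasFDerivAt_fderiv_comp_quadratic (hφ : Differentiable ℝ φ)
    (hφ' : Differentiable ℝ (fderiv ℝ φ)) (hB : ∀ x y, B x y = B y x) (x : E) :
    ∃ D : E →L[ℝ] E →L[ℝ] ℝ, HasFDerivAt (fderiv ℝ (fun x => φ (B x x))) D x ∧
      ∀ v w, D v w = fderiv ℝ φ (B x x) ((2 : ℝ) • B v w) +
        fderiv ℝ (fderiv ℝ φ) (B x x) ((2 : ℝ) • B x v) ((2 : ℝ) • B x w) := by
  have h0 : fderiv ℝ (fun x => φ (B x x)) = fun x => (fderiv ℝ φ (B x x)).comp ((2 : ℝ) • B x) :=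
    funext fun x => (hasFDerivAt_comp_quadratic hφ hB x).fderiv
  have h2 : HasFDerivAt (fun x => fderiv ℝ φ (B x x)) _ x :=
    (hφ' (B x x)).hasFDerivAt.comp (f := fun x => B x x) x (hasFDerivAt_quadratic hB x)
  have h3 : HasFDerivAt (fun x => (2 : ℝ) • B x) ((2 : ℝ) • B) x :=
    ((2 : ℝ) • B).hasFDerivAt
  rw [h0]
  refine ⟨_, h2.clm_comp h3, fun v w => ?_⟩
  simp

variable [FiniteDimensional ℝ E] {b : E →ₗ[ℝ] E →ₗ[ℝ] F}

theorem isSecondOrderPoint_comp_quadratic_iff (hφ : Differentiable ℝ φ)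
    (hφ' : Differentiable ℝ (fderiv ℝ φ)) (hb : ∀ x y, b x y = b y x) {x : E} :
    IsSecondOrderPoint (fun x => φ (b x x)) x ↔
      (∀ v, fderiv ℝ φ (b x x) (b x v) = 0) ∧
        ∀ v, 0 ≤ 2 * fderiv ℝ φ (b x x) (b v v) + hessianForm φ (b x x) ((2 : ℝ) • b x v) := by
  let B : E →L[ℝ] E →L[ℝ] F := b.toContinuousBilinearMap
  have hB : ∀ x y, B x y = B y x := hb
  obtain ⟨D, hD, h⟩ := exists_hasFDerivAt_fderiv_comp_quadratic hφ hφ' hB x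
  refine and_congr ?_ (forall_congr' fun v => ?_)
  · change fderiv ℝ (fun x => φ (B x x)) x = 0 ↔ ∀ v, fderiv ℝ φ (B x x) (B x v) = 0
    rw [(hasFDerivAt_comp_quadratic hφ hB x).fderiv, ContinuousLinearMap.ext_iff]
    simp
  · change 0 ≤ fderiv ℝ (fderiv ℝ (fun x => φ (B x x))) x v v ↔
      0 ≤ 2 * fderiv ℝ φ (B x x) (B v v) + hessianForm φ (B x x) ((2 : ℝ) • B x v)
    rw [hD.fderiv, h, map_smul, smul_eq_mul, hessianForm]

theorem IsMinOn.isSecondOrderPoint_comp_quadratic (hφ : Differentiable ℝ φ)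
    (hφ' : Differentiable ℝ (fderiv ℝ φ)) (hb : ∀ x y, b x y = b y x) {x : E}
    (h : IsMinOn (fun x => φ (b x x)) Set.univ x) : IsSecondOrderPoint (fun x => φ (b x x)) x := by
  let B : E →L[ℝ] E →L[ℝ] F := b.toContinuousBilinearMap
  have hB : ∀ x y, B x y = B y x := hb
  obtain ⟨D, hD, -⟩ := exists_hasFDerivAt_fderiv_comp_quadratic hφ hφ' hB x
  exact h.isSecondOrderPoint (fun y => (hasFDerivAt_comp_quadratic hφ hB y).differentiableAt)
    hD.differentiableAt

end Quadratic

section BurerMonteiro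

variable {n r : ℕ} {φ : SymMat n → ℝ}

theorem burerMonteiro_eq (φ : SymMat n → ℝ) (r : ℕ) :
    burerMonteiro φ r = fun U => φ (gramBilin n r U U) :=
  funext fun U => by rw [burerMonteiro, gramSym_eq_symPart, gramBilin_apply]

theorem isSecondOrderPoint_burerMonteiro_iff (hφ : TwiceDifferentiable φ)
    {X : Matrix (Fin n) (Fin r) ℝ} :
    IsSecondOrderPoint (burerMonteiro φ r) X ↔
      (∀ V : Matrix (Fin n) (Fin r) ℝ, fderiv ℝ φ (gramSym X) (symPart n (X * Vᵀ)) = 0) ∧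
        ∀ V : Matrix (Fin n) (Fin r) ℝ, 0 ≤ 2 * fderiv ℝ φ (gramSym X) (symPart n (V * Vᵀ)) +
          hessianForm φ (gramSym X) ((2 : ℝ) • symPart n (X * Vᵀ)) := by
  rw [burerMonteiro_eq, gramSym_eq_symPart]
  exact isSecondOrderPoint_comp_quadratic_iff hφ.1 hφ.2 gramBilin_comm

theorem IsMinOn.isSecondOrderPoint_burerMonteiro (hφ : TwiceDifferentiable φ)
    {X : Matrix (Fin n) (Fin r) ℝ} (h : IsMinOn (burerMonteiro φ r) Set.univ X) :
    IsSecondOrderPoint (burerMonteiro φ r) X := by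
  rw [burerMonteiro_eq] at h ⊢
  exact h.isSecondOrderPoint_comp_quadratic hφ.1 hφ.2 gramBilin_comm

end BurerMonteiro

/-! ### Optimality on the cone, cocoercivity, and absence of spurious minima. -/

theorem toMatrix_two_smul_symPart {n : ℕ} (A : Matrix (Fin n) (Fin n) ℝ) :
    ((2 : ℝ) • symPart n A).toMatrix = A + Aᵀ := by
  change (2 : ℝ) • (symPart n A).toMatrix = _
  rw [toMatrix_symPart, smul_smul]; norm_num

/-- A positive semidefinite matrix of rank at most `r` is the Gram matrix of an `n × r` matrix. -/
theorem exists_gramSym_eq {n r : ℕ} {M : SymMat n} (hM : M.toMatrix.PosSemidef)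
    (hr : M.toMatrix.rank ≤ r) : ∃ Z : Matrix (Fin n) (Fin r) ℝ, gramSym Z = M := by
  obtain ⟨R, -, -, hR⟩ := hM.isHermitian.exists_orthogonal_eq
  have h0 : ∀ i, 0 ≤ hM.isHermitian.eigenvalues i := hM.eigenvalues_nonneg
  have hcard : Fintype.card {i // hM.isHermitian.eigenvalues i ≠ 0} ≤ Fintype.card (Fin r) := by
    rwa [← hM.isHermitian.rank_eq_card_non_zero_eigs, Fintype.card_fin]
  generalize hM.isHermitian.eigenvalues = e at *
  obtain ⟨g⟩ := Function.Embedding.nonempty_of_card_le hcard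
  -- A square root of `diagonal e` whose nonzero columns are packed into `r` columns by `g`.
  obtain ⟨B, hB⟩ : ∃ B : Matrix (Fin n) (Fin r) ℝ, B = Matrix.of fun i k =>
    if h : e i ≠ 0 then if g ⟨i, h⟩ = k then √(e i) else 0 else 0 := ⟨_, rfl⟩
  have hBB : B * Bᵀ = diagonal e := by
    ext i j
    simp only [mul_apply, transpose_apply, hB, Matrix.of_apply, diagonal_apply]
    by_cases hi : e i = 0
    · simp [hi]
    by_cases hj : e j = 0
    · simp only [hj]
      have : i ≠ j := fun h => hi (h ▸ hj)
      simp [this]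
    by_cases hij : i = j
    · subst hij
      simp [hi, Real.mul_self_sqrt (h0 i)]
    · simp [hi, hj, hij, g.injective.eq_iff, eq_comm]
  refine ⟨R * B, SymMat.toMatrix_injective ?_⟩
  rw [toMatrix_gramSym, transpose_mul, Matrix.mul_assoc, ← Matrix.mul_assoc B, hBB,
    ← Matrix.mul_assoc, ← hR]

theorem IsPSDMinimizer.fderiv_nonneg {n : ℕ} {φ : SymMat n → ℝ} {M N : SymMat n}
    (h : IsPSDMinimizer φ M) (hφ : Differentiable ℝ φ) (hN : N.toMatrix.PosSemidef) :
    0 ≤ fderiv ℝ φ M (N - M) := by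
  have hmin : IsMinOn φ {N : SymMat n | N.toMatrix.PosSemidef} M := fun N hN => h.2 N hN
  refine hmin.localize.hasFDerivWithinAt_nonneg (hφ M).hasFDerivAt.hasFDerivWithinAt
    (sub_mem_posTangentConeAt_of_segment_subset ?_)
  rintro _ ⟨a, b, ha, hb, -, rfl⟩
  exact (h.1.smul ha).add (hN.smul hb)

/-- Cocoercivity of the gradient of a smooth strongly convex function, in a dual form. -/
theorem cocoercive_dual {n : ℕ} {φ : SymMat n → ℝ} {L μ : ℝ} (hφ : TwiceDifferentiable φ)
    (hL : IsSmoothWith φ L) (hμ : IsStronglyConvexWith φ μ) (hμL : μ < L) (A B T : SymMat n) :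
    0 ≤ (L + μ) * (fderiv ℝ φ A (A - B) - fderiv ℝ φ B (A - B)) +
      2 * (fderiv ℝ φ A T - fderiv ℝ φ B T) + ‖T‖ ^ 2 - μ * L * ‖A - B‖ ^ 2 := by
  obtain ⟨E, hE⟩ : ∃ E, E = A - B := ⟨_, rfl⟩
  -- For fixed `T` the gradient difference enters only through its value on `V`, so the scalar mean
  -- value theorem suffices and the Hessian need not be continuous. With `H` the Hessian at the mean
  -- value point, `H(LE + T, LE + T) - H(μE + T, μE + T) = (L - μ) H(E, V)`.
  obtain ⟨V, hV⟩ : ∃ V, V = (L + μ) • E + (2 : ℝ) • T := ⟨_, rfl⟩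
  have hline : ∀ t : ℝ, HasDerivAt (fun t : ℝ => B + t • E) E t := fun t => by
    simpa using ((hasDerivAt_id t).smul_const E).const_add B
  have hder : ∀ t : ℝ, HasDerivAt (fun t : ℝ => fderiv ℝ φ (B + t • E) V)
      (fderiv ℝ (fderiv ℝ φ) (B + t • E) E V) t := fun t => by
    simpa using ((hφ.2 _).hasFDerivAt.comp_hasDerivAt t (hline t)).clm_apply
      (hasDerivAt_const t V)
  obtain ⟨c, -, hc⟩ := exists_hasDerivAt_eq_slope _ _ zero_lt_one
    (fun t _ => (hder t).continuousAt.continuousWithinAt) fun t _ => hder t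
  have hsymm := second_derivative_symmetric (fun y => (hφ.1 y).hasFDerivAt)
    (hφ.2 (B + c • E)).hasFDerivAt E T
  have h1 := hμ (B + c • E) (L • E + T)
  have h2 := hL (B + c • E) (μ • E + T)
  have hn : ∀ a : ℝ, ‖a • E + T‖ ^ 2 = a ^ 2 * ‖E‖ ^ 2 +
      2 * a * (E.toMatrix * T.toMatrix).trace + ‖T‖ ^ 2 := fun a => by
    simp only [SymMat.norm_sq_eq]
    change ((a • E.toMatrix + T.toMatrix) * (a • E.toMatrix + T.toMatrix)).trace = _
    simp only [Matrix.add_mul, Matrix.mul_add, Matrix.smul_mul, Matrix.mul_smul, trace_add,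
      trace_smul, smul_eq_mul, trace_mul_comm T.toMatrix]
    ring
  rw [hn] at h1 h2
  have hBE : B + (1 : ℝ) • E = A := by rw [hE]; simp
  simp only [hessianForm, map_add, map_smul, _root_.add_apply, _root_.smul_apply,
    smul_eq_mul] at h1 h2
  simp only [hV, hBE, zero_smul, add_zero, map_add, map_smul, smul_eq_mul, sub_zero, div_one] at hc
  rw [← hE]
  have hpos : 0 < L - μ := sub_pos.2 hμL
  refine nonneg_of_mul_nonneg_right (a := L - μ) ?_ hpos
  rw [← hsymm] at h1 h2
  linear_combination h1 + h2 + (L - μ) * hc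

theorem noSpuriousLocalMinima_burerMonteiro {n r : ℕ} {φ : SymMat n → ℝ} {L μ : ℝ} {M : SymMat n}
    (hμ : 0 < μ) (hμL : μ < L) (hL : L < 3 * μ) (hφ : TwiceDifferentiable φ)
    (hφL : IsSmoothWith φ L) (hφμ : IsStronglyConvexWith φ μ) (hM : IsPSDMinimizer φ M)
    (hr : M.toMatrix.rank ≤ r) : NoSpuriousLocalMinima (burerMonteiro φ r) := by
  obtain ⟨Z, rfl⟩ := exists_gramSym_eq hM.1 hr
  have hZ : IsMinOn (burerMonteiro φ r) Set.univ Z := fun U _ => hM.2 _ (posSemidef_gramSym U)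
  refine ⟨⟨Z, hZ⟩, fun X => ⟨fun hX => ?_, fun hX => hX.isSecondOrderPoint_burerMonteiro hφ⟩⟩
  obtain ⟨h1, h2⟩ := (isSecondOrderPoint_burerMonteiro_iff hφ).1 hX
  suffices h : gramSym X = gramSym Z by
    intro U hU
    have := hZ hU
    simpa only [burerMonteiro, h] using this
  apply SymMat.toMatrix_injective
  rw [toMatrix_gramSym, toMatrix_gramSym]
  have hE : symPart n (X * Xᵀ - Z * Zᵀ) = gramSym X - gramSym Z := by
    rw [map_sub, gramSym_eq_symPart, gramSym_eq_symPart]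
  refine gram_eq_gram_of_secondOrder hμ hμL hL X Z
    ((fderiv ℝ φ (gramSym X)).toLinearMap ∘ₗ symPart n)
    ((fderiv ℝ φ (gramSym Z)).toLinearMap ∘ₗ symPart n)
    (fun A => ?_) h1 (fun V => ?_) (fun V => ?_) rfl ?_ fun T hT => ?_
  · simp only [LinearMap.comp_apply, symPart_transpose]
  · have h3 := hφL (gramSym X) ((2 : ℝ) • symPart n (X * Vᵀ))
    rw [SymMat.norm_sq_eq, toMatrix_two_smul_symPart, transpose_mul, transpose_transpose] at h3
    exact (h2 V).trans (add_le_add le_rfl h3)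
  -- Moving from the minimizer by `V Vᵀ` stays in the cone, hence `t ⪰ 0`.
  · have := hM.fderiv_nonneg (N := gramSym Z + gramSym V) hφ.1 (hM.1.add (posSemidef_gramSym V))
    rw [add_sub_cancel_left, gramSym_eq_symPart V] at this
    exact this
  · have := hM.fderiv_nonneg hφ.1 (posSemidef_gramSym X)
    rw [← hE] at this
    exact this
  · have hTs : (symPart n T).toMatrix = T := by
      rw [toMatrix_symPart, hT, ← two_smul ℝ, smul_smul]; norm_num
    have := cocoercive_dual hφ hφL hφμ hμL (gramSym X) (gramSym Z) (symPart n T)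
    rw [SymMat.norm_sq_eq, SymMat.norm_sq_eq, hTs, ← hE] at this
    have hEs : (symPart n (X * Xᵀ - Z * Zᵀ)).toMatrix = X * Xᵀ - Z * Zᵀ := by rw [hE]; rfl
    rw [hEs] at this
    exact this

/-! ### The counterexample for `L ≥ 3μ`. -/

section TranslatedQuadratic

variable {E : Type*} [NormedAddCommGroup E] [NormedSpace ℝ E] {B : E →L[ℝ] E →L[ℝ] ℝ}

theorem fderiv_quadratic_sub (hB : ∀ x y, B x y = B y x) (a : E) :
    (fderiv ℝ fun x => B (x - a) (x - a)) = fun x => (2 : ℝ) • B (x - a) :=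
  funext fun x => ((hasFDerivAt_quadratic hB (x - a)).comp (f := fun x => x - a) x
    ((hasFDerivAt_id x).sub_const a)).fderiv

theorem hasFDerivAt_fderiv_quadratic_sub (hB : ∀ x y, B x y = B y x) (a x : E) :
    HasFDerivAt (fderiv ℝ fun x => B (x - a) (x - a)) ((2 : ℝ) • B) x := by
  rw [fderiv_quadratic_sub hB]
  exact ((2 : ℝ) • B).hasFDerivAt.comp (f := fun x => x - a) x ((hasFDerivAt_id x).sub_const a)

theorem twiceDifferentiable_quadratic_sub (hB : ∀ x y, B x y = B y x) (a : E) :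
    TwiceDifferentiable fun x => B (x - a) (x - a) :=
  ⟨fun x => ((hasFDerivAt_quadratic hB (x - a)).comp (f := fun x => x - a) x
    ((hasFDerivAt_id x).sub_const a)).differentiableAt,
    fun x => (hasFDerivAt_fderiv_quadratic_sub hB a x).differentiableAt⟩

theorem hessianForm_quadratic_sub (hB : ∀ x y, B x y = B y x) (a x v : E) :
    hessianForm (fun x => B (x - a) (x - a)) x v = 2 * B v v := by
  rw [hessianForm, (hasFDerivAt_fderiv_quadratic_sub hB a x).fderiv]
  rfl

end TranslatedQuadratic

/-- The bilinear form `½ μ (3 tr(E F) - (E i i - E p p) (F i i - F p p))`. -/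
noncomputable def gapForm {n : ℕ} (μ : ℝ) (i p : Fin n) : SymMat n →L[ℝ] SymMat n →L[ℝ] ℝ :=
  LinearMap.toContinuousBilinearMap <| LinearMap.mk₂ ℝ
    (fun E F : SymMat n => μ / 2 * (3 * (E.toMatrix * F.toMatrix).trace -
      (E.toMatrix i i - E.toMatrix p p) * (F.toMatrix i i - F.toMatrix p p)))
    (fun E E' F => by
      change μ / 2 * (3 * ((E.toMatrix + E'.toMatrix) * F.toMatrix).trace -
        (E.toMatrix i i + E'.toMatrix i i - (E.toMatrix p p + E'.toMatrix p p)) * _) = _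
      rw [Matrix.add_mul, trace_add]; ring)
    (fun c E F => by
      change μ / 2 * (3 * ((c • E.toMatrix) * F.toMatrix).trace -
        (c * E.toMatrix i i - c * E.toMatrix p p) * _) = _
      rw [Matrix.smul_mul, trace_smul]; simp only [smul_eq_mul]; ring)
    (fun E F F' => by
      change μ / 2 * (3 * (E.toMatrix * (F.toMatrix + F'.toMatrix)).trace -
        _ * (F.toMatrix i i + F'.toMatrix i i - (F.toMatrix p p + F'.toMatrix p p))) = _
      rw [Matrix.mul_add, trace_add]; ring)
    (fun c E F => by
      change μ / 2 * (3 * (E.toMatrix * (c • F.toMatrix)).trace -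
        _ * (c * F.toMatrix i i - c * F.toMatrix p p)) = _
      rw [Matrix.mul_smul, trace_smul]; simp only [smul_eq_mul]; ring)

section GapForm

variable {n : ℕ} {μ : ℝ} {i p : Fin n}

theorem gapForm_apply (E F : SymMat n) :
    gapForm μ i p E F = μ / 2 * (3 * (E.toMatrix * F.toMatrix).trace -
      (E.toMatrix i i - E.toMatrix p p) * (F.toMatrix i i - F.toMatrix p p)) := rfl

theorem gapForm_comm (E F : SymMat n) : gapForm μ i p E F = gapForm μ i p F E := by
  rw [gapForm_apply, gapForm_apply, trace_mul_comm]; ring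

theorem SymMat.trace_mul_self {n : ℕ} (E : SymMat n) :
    (E.toMatrix * E.toMatrix).trace = ∑ a, ∑ b, E.toMatrix a b ^ 2 := by
  simp only [trace, diag_apply, mul_apply]
  refine Finset.sum_congr rfl fun a _ => Finset.sum_congr rfl fun b _ => ?_
  rw [sq, ← transpose_apply E.toMatrix a b, E.transpose_toMatrix]

theorem gapForm_le (hμ : 0 ≤ μ) (E : SymMat n) : 2 * gapForm μ i p E E ≤ 3 * μ * ‖E‖ ^ 2 := by
  rw [gapForm_apply, SymMat.norm_sq_eq]
  nlinarith [mul_nonneg hμ (mul_self_nonneg (E.toMatrix i i - E.toMatrix p p))]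

/-- Twice the form is `3μ` times the identity minus `μ G ⊗ G` with `G = eᵢeᵢᵀ - eₚeₚᵀ`. Since `‖G‖²
= 2` for `i ≠ p`, its value drops to `μ` along `G`. -/
theorem le_gapForm (hμ : 0 ≤ μ) (hip : i ≠ p) (E : SymMat n) :
    μ * ‖E‖ ^ 2 ≤ 2 * gapForm μ i p E E := by
  have h : E.toMatrix i i ^ 2 + E.toMatrix p p ^ 2 ≤ ‖E‖ ^ 2 := by
    rw [SymMat.norm_sq_eq, SymMat.trace_mul_self]
    calc E.toMatrix i i ^ 2 + E.toMatrix p p ^ 2 = ∑ a ∈ {i, p}, E.toMatrix a a ^ 2 := by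
          rw [Finset.sum_pair hip]
      _ ≤ ∑ a, E.toMatrix a a ^ 2 :=
          Finset.sum_le_sum_of_subset_of_nonneg (Finset.subset_univ _) fun _ _ _ => sq_nonneg _
      _ ≤ _ := Finset.sum_le_sum fun a _ =>
          Finset.single_le_sum (f := fun b => E.toMatrix a b ^ 2) (fun _ _ => sq_nonneg _)
            (Finset.mem_univ a)
  rw [gapForm_apply, ← SymMat.norm_sq_eq]
  have h2 : (E.toMatrix i i - E.toMatrix p p) ^ 2 ≤ 2 * ‖E‖ ^ 2 := by
    nlinarith [sq_nonneg (E.toMatrix i i + E.toMatrix p p)]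
  nlinarith [mul_le_mul_of_nonneg_left h2 hμ]

end GapForm

/-- The matrix with the single nonzero entry `w j` in column `j`, in row `κ j`. -/
def columnMatrix {n r : ℕ} (κ : Fin r → Fin n) (w : Fin r → ℝ) : Matrix (Fin n) (Fin r) ℝ :=
  Matrix.of fun a j => if a = κ j then w j else 0

section ColumnMatrix

variable {n r : ℕ} {κ : Fin r → Fin n} {w : Fin r → ℝ}

theorem columnMatrix_transpose_mul_self (hκ : Function.Injective κ) :
    (columnMatrix κ w)ᵀ * columnMatrix κ w = diagonal fun j => w j ^ 2 := by
  ext j k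
  simp only [columnMatrix, mul_apply, transpose_apply, Matrix.of_apply, diagonal_apply]
  by_cases h : j = k
  · subst h; simp [sq]
  · simp [h, hκ.eq_iff, Ne.symm h]

theorem columnMatrix_mul_apply {m : Type*} [Fintype m] (V : Matrix m (Fin r) ℝ) (a : Fin n) (b : m) :
    (columnMatrix κ w * Vᵀ) a b = ∑ j, if a = κ j then w j * V b j else 0 := by
  simp only [columnMatrix, mul_apply, transpose_apply, Matrix.of_apply, ite_mul, zero_mul]

theorem trace_columnMatrix_gram_mul (F : Matrix (Fin n) (Fin n) ℝ) :
    (columnMatrix κ w * (columnMatrix κ w)ᵀ * F).trace = ∑ j, w j ^ 2 * F (κ j) (κ j) := by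
  rw [Matrix.mul_assoc, trace_mul_comm, trace]
  refine Finset.sum_congr rfl fun j _ => ?_
  simp only [columnMatrix, diag_apply, mul_apply, transpose_apply, Matrix.of_apply, ite_mul,
    mul_ite, zero_mul, mul_zero, Finset.sum_ite_eq', Finset.mem_univ, if_true]
  ring

theorem columnMatrix_gram_apply_self (a : Fin n) :
    (columnMatrix κ w * (columnMatrix κ w)ᵀ) a a = ∑ j, if a = κ j then w j ^ 2 else 0 := by
  rw [columnMatrix_mul_apply]
  refine Finset.sum_congr rfl fun j _ => ?_
  by_cases h : a = κ j <;> simp [columnMatrix, h, sq]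

end ColumnMatrix

theorem exists_spurious_burerMonteiro {n r : ℕ} {L μ : ℝ} (hμ : 0 < μ) (hL : 3 * μ ≤ L)
    (hr : 1 ≤ r) (hrn : r < n) :
    ∃ (φ : SymMat n → ℝ) (M : SymMat n),
      TwiceDifferentiable φ ∧ IsSmoothWith φ L ∧ IsStronglyConvexWith φ μ ∧
      IsPSDMinimizer φ M ∧ M.toMatrix.rank = r ∧
      ∃ X U : Matrix (Fin n) (Fin r) ℝ,
        IsSecondOrderPoint (burerMonteiro φ r) X ∧
        IsMinOn (burerMonteiro φ r) Set.univ U ∧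
        burerMonteiro φ r X - burerMonteiro φ r U > μ := by
  let e : Fin (r + 1) ↪ Fin n := Fin.castLEEmb hrn
  obtain ⟨p, hp⟩ : ∃ p, p = e (Fin.last r) := ⟨_, rfl⟩
  obtain ⟨ι, hι⟩ : ∃ ι : Fin r → Fin n, ι = fun j => e j.castSucc := ⟨_, rfl⟩
  have hιinj : Function.Injective ι := by
    rw [hι]; exact e.injective.comp (Fin.castSucc_injective r)
  have hpι : ∀ j, p ≠ ι j := fun j => by
    rw [hp, hι]; exact e.injective.ne (Fin.castSucc_lt_last j).ne'
  have hsum : ∀ g : Fin n → ℝ, (∀ a, 0 ≤ g a) → ∑ j, g (ι j) + g p ≤ ∑ a, g a := fun g hg => by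
    rw [hp, hι]
    rw [← Fin.sum_univ_castSucc fun x => g (e x), ← Finset.sum_map Finset.univ e g]
    exact Finset.sum_le_sum_of_subset_of_nonneg (Finset.subset_univ _) fun a _ _ => hg a
  obtain ⟨j₀⟩ : Nonempty (Fin r) := ⟨⟨0, hr⟩⟩
  -- The minimizer agrees with `X Xᵀ` except that axis `ι j₀` is replaced by axis `p` with weight
  -- `(√2)² = 2`.
  obtain ⟨κ, hκ⟩ : ∃ κ : Fin r → Fin n, κ = fun j => if j = j₀ then p else ι j := ⟨_, rfl⟩
  obtain ⟨w, hw⟩ : ∃ w : Fin r → ℝ, w = fun j => if j = j₀ then √2 else 1 := ⟨_, rfl⟩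
  have hκinj : Function.Injective κ := fun j k h => by
    simp only [hκ] at h
    split_ifs at h with h1 h2 h2
    · rw [h1, h2]
    · exact absurd h (hpι k)
    · exact absurd h.symm (hpι j)
    · exact hιinj h
  have hκ0 : κ j₀ = p := by simp [hκ]
  have hκj : ∀ j, j ≠ j₀ → κ j = ι j := fun j hj => by simp [hκ, hj]
  have hw0 : w j₀ ^ 2 = 2 := by simp [hw]
  have hwj : ∀ j, j ≠ j₀ → w j = 1 := fun j hj => by simp [hw, hj]
  obtain ⟨X, hX⟩ : ∃ X, X = columnMatrix ι fun _ => 1 := ⟨_, rfl⟩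
  obtain ⟨U, hU⟩ : ∃ U, U = columnMatrix κ w := ⟨_, rfl⟩
  obtain ⟨B, hB⟩ : ∃ B, B = gapForm μ (ι j₀) p := ⟨_, rfl⟩
  have hBc : ∀ x y, B x y = B y x := hB ▸ gapForm_comm
  have hB0 : ∀ x, 0 ≤ B x x := fun x => by
    have := le_gapForm hμ.le (hpι j₀).symm x
    rw [← hB] at this
    have := mul_nonneg hμ.le (sq_nonneg ‖x‖)
    linarith
  have hXp : ∀ V : Matrix (Fin n) (Fin r) ℝ, ∀ b, (X * Vᵀ) p b = 0 := fun V b => by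
    rw [hX, columnMatrix_mul_apply]
    exact Finset.sum_eq_zero fun j _ => if_neg (hpι j)
  have hXι : ∀ V : Matrix (Fin n) (Fin r) ℝ, ∀ j b, (X * Vᵀ) (ι j) b = V b j := fun V j b => by
    rw [hX, columnMatrix_mul_apply, Finset.sum_eq_single j]
    · simp
    · intro k _ hk
      exact if_neg fun h => hk (hιinj h).symm
    · simp
  have hUι : (U * Uᵀ) (ι j₀) (ι j₀) = 0 := by
    rw [hU, columnMatrix_gram_apply_self]
    refine Finset.sum_eq_zero fun j _ => if_neg ?_
    by_cases hj : j = j₀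
    · rw [hj, hκ0]; exact (hpι j₀).symm
    · rw [hκj j hj]; exact fun h => hj (hιinj h).symm
  have hUp : (U * Uᵀ) p p = 2 := by
    rw [hU, columnMatrix_gram_apply_self, Finset.sum_eq_single j₀]
    · rw [if_pos hκ0.symm, hw0]
    · intro j _ hj
      rw [hκj j hj]; exact if_neg (hpι j)
    · simp
  -- The weight 2 cancels the `ι j₀` entry, so the gradient at `X Xᵀ` is `-3μ eₚeₚᵀ`, which
  -- annihilates `X`.
  have hBE : ∀ F, B (gramSym X - gramSym U) F = - (3 * μ / 2) * F.toMatrix p p := fun F => by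
    rw [hB, gapForm_apply]
    change μ / 2 * (3 * ((X * Xᵀ - U * Uᵀ) * F.toMatrix).trace -
      ((X * Xᵀ) (ι j₀) (ι j₀) - (U * Uᵀ) (ι j₀) (ι j₀) - ((X * Xᵀ) p p - (U * Uᵀ) p p)) * _) = _
    have htr : ((X * Xᵀ - U * Uᵀ) * F.toMatrix).trace =
        F.toMatrix (ι j₀) (ι j₀) - 2 * F.toMatrix p p := by
      rw [Matrix.sub_mul, trace_sub, hX, hU, trace_columnMatrix_gram_mul,
        trace_columnMatrix_gram_mul, ← Finset.sum_sub_distrib, Finset.sum_eq_single j₀]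
      · rw [hκ0, hw0]; ring
      · intro j _ hj
        rw [hκj j hj, hwj j hj]; ring
      · simp
    have hX1 : X (ι j₀) j₀ = 1 := by simp [hX, columnMatrix]
    rw [htr, hXι, hX1, hXp, hUι, hUp]
    ring
  have hφ := twiceDifferentiable_quadratic_sub hBc (gramSym U)
  have hmin : IsPSDMinimizer (fun M => B (M - gramSym U) (M - gramSym U)) (gramSym U) :=
    ⟨posSemidef_gramSym U, fun N _ => by simpa using hB0 (N - gramSym U)⟩
  refine ⟨fun M => B (M - gramSym U) (M - gramSym U), gramSym U, hφ, fun M E => ?_, fun M E => ?_,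
    hmin, ?_, X, U, (isSecondOrderPoint_burerMonteiro_iff hφ).2 ⟨fun V => ?_, fun V => ?_⟩,
    fun V _ => hmin.2 _ (posSemidef_gramSym V), ?_⟩
  · rw [hessianForm_quadratic_sub hBc, hB]
    exact (gapForm_le hμ.le E).trans (mul_le_mul_of_nonneg_right hL (sq_nonneg _))
  · rw [hessianForm_quadratic_sub hBc, hB]
    exact le_gapForm hμ.le (hpι j₀).symm E
  · rw [toMatrix_gramSym, rank_self_mul_transpose, ← rank_transpose_mul_self, hU,
      columnMatrix_transpose_mul_self hκinj, rank_diagonal]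
    have : ∀ j, w j ^ 2 ≠ 0 := fun j => by
      by_cases hj : j = j₀
      · rw [hj, hw0]; norm_num
      · rw [hwj j hj]; norm_num
    simp [this]
  · rw [fderiv_quadratic_sub hBc]
    change 2 * B (gramSym X - gramSym U) _ = 0
    rw [hBE, toMatrix_symPart, Matrix.smul_apply, Matrix.add_apply, transpose_apply, hXp]
    simp
  · rw [fderiv_quadratic_sub hBc, hessianForm_quadratic_sub hBc]
    change 0 ≤ 2 * (2 * B (gramSym X - gramSym U) _) + _
    obtain ⟨W, hW⟩ : ∃ W, W = (2 : ℝ) • symPart n (X * Vᵀ) := ⟨_, rfl⟩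
    have hWm : W.toMatrix = X * Vᵀ + (X * Vᵀ)ᵀ := by rw [hW, toMatrix_two_smul_symPart]
    have hWp : W.toMatrix p p = 0 := by
      rw [hWm, Matrix.add_apply, transpose_apply, hXp, add_zero]
    have hWιp : ∀ j, W.toMatrix (ι j) p = V p j := fun j => by
      rw [hWm, Matrix.add_apply, transpose_apply, hXp, hXι, add_zero]
    have hWpι : ∀ j, W.toMatrix p (ι j) = V p j := fun j => by
      rw [hWm, Matrix.add_apply, transpose_apply, hXp, hXι, zero_add]
    have hVp : (symPart n (V * Vᵀ)).toMatrix p p = ∑ j, V p j ^ 2 := by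
      rw [toMatrix_symPart, Matrix.smul_apply, Matrix.add_apply, transpose_apply, mul_apply]
      simp only [transpose_apply, sq, smul_eq_mul]
      ring
    -- Row `p` and column `p` of `W` each contain all the entries `V p j`. The resulting factor 2
    -- exactly offsets the negative curvature `-6μ ∑ (V p j)²` coming from the gradient.
    have hWW : 2 * ∑ j, V p j ^ 2 + W.toMatrix (ι j₀) (ι j₀) ^ 2 ≤
        (W.toMatrix * W.toMatrix).trace := by
      rw [SymMat.trace_mul_self]
      have h1 := hsum (fun a => ∑ b, W.toMatrix a b ^ 2)
        fun a => Finset.sum_nonneg fun b _ => sq_nonneg _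
      have h2 : ∑ j, V p j ^ 2 ≤ ∑ b, W.toMatrix p b ^ 2 := by
        have := hsum (fun b => W.toMatrix p b ^ 2) fun b => sq_nonneg _
        simp only [hWpι] at this
        linarith [sq_nonneg (W.toMatrix p p)]
      have h3 : ∑ j, (V p j ^ 2 + W.toMatrix (ι j) (ι j) ^ 2) ≤
          ∑ j, ∑ b, W.toMatrix (ι j) b ^ 2 := Finset.sum_le_sum fun j _ => by
        rw [← hWιp j, ← Finset.sum_pair (f := fun b => W.toMatrix (ι j) b ^ 2) (hpι j)]
        exact Finset.sum_le_sum_of_subset_of_nonneg (Finset.subset_univ _) fun _ _ _ => sq_nonneg _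
      have h4 : W.toMatrix (ι j₀) (ι j₀) ^ 2 ≤ ∑ j, W.toMatrix (ι j) (ι j) ^ 2 :=
        Finset.single_le_sum (f := fun j => W.toMatrix (ι j) (ι j) ^ 2) (fun _ _ => sq_nonneg _)
          (Finset.mem_univ j₀)
      rw [Finset.sum_add_distrib] at h3
      linarith
    rw [← hW, hBE, hVp, hB, gapForm_apply, hWp]
    nlinarith [mul_le_mul_of_nonneg_left hWW hμ.le,
      mul_nonneg hμ.le (sq_nonneg (W.toMatrix (ι j₀) (ι j₀)))]
  · change μ < B (gramSym X - gramSym U) (gramSym X - gramSym U) -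
      B (gramSym U - gramSym U) (gramSym U - gramSym U)
    rw [hBE, sub_self, map_zero]
    change μ < -(3 * μ / 2) * ((X * Xᵀ) p p - (U * Uᵀ) p p) - 0
    rw [hXp, hUp]
    linarith

theorem mainTheorem2 (n r : ℕ) (L μ : ℝ) (hμ : 0 < μ) :
    (L / μ < 3 →
      ∀ (φ : SymMat n → ℝ) (M : SymMat n),
        TwiceDifferentiable φ → IsSmoothWith φ L → IsStronglyConvexWith φ μ →
        IsPSDMinimizer φ M → M.toMatrix.rank ≤ r →
        NoSpuriousLocalMinima (burerMonteiro φ r)) ∧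
    (3 ≤ L / μ → 1 ≤ r → r < n →
      ∃ (φ : SymMat n → ℝ) (M : SymMat n),
        TwiceDifferentiable φ ∧ IsSmoothWith φ L ∧ IsStronglyConvexWith φ μ ∧
        IsPSDMinimizer φ M ∧ M.toMatrix.rank = r ∧
        ∃ X U : Matrix (Fin n) (Fin r) ℝ,
          IsSecondOrderPoint (burerMonteiro φ r) X ∧
          IsMinOn (burerMonteiro φ r) Set.univ U ∧
          burerMonteiro φ r X - burerMonteiro φ r U > μ) := by
  refine ⟨fun hL φ M hφ hφL hφμ hM hr => ?_, fun hL hr hrn =>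
    exists_spurious_burerMonteiro hμ ((le_div_iff₀ hμ).1 hL) hr hrn⟩
  rw [div_lt_iff₀ hμ] at hL
  -- Raising the smoothness constant to at least `2μ` secures `μ < L`, needed to cancel `L - μ`,
  -- while staying below `3μ`.
  refine noSpuriousLocalMinima_burerMonteiro (L := max L (2 * μ)) hμ
    (lt_max_of_lt_right (by linarith)) (max_lt hL (by linarith)) hφ (fun A E => ?_) hφμ hM hr
  exact (hφL A E).trans (mul_le_mul_of_nonneg_right (le_max_left _ _) (sq_nonneg _))
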